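/- Let $\Omega\subset\mathbb{R}^N$ be a bounded domain, $\sigma\in(0,1)$, $m\in(\sigma,1]$, $\theta\in[0,m)$, $b_0,A>0$. Let $\{\nu_x\}_{x\in\mathbb{R}^N}$ be a family of Borel measures on $\mathbb{R}^N$ satisfying, with constants $c_1(R,\alpha),c_2(R,\alpha)$: (M1) for all $R>0$, $\alpha\in[0,2]$, $\delta>0$: $\ \sup_{|x|\le R}\int_{B_\delta^c}\min\{1,|z|^\alpha\}\,\nu_x(dz)\le c_1(R,\alpha)\,h_{\alpha,\sigma}(\delta)$, where $h_{\alpha,\sigma}(\delta)=\delta^{\alpha-\sigma}$ if $\alpha<\sigma$, $|\ln\delta|+1$ if $\alpha=\sigma$, and $1$ if $\alpha>\sigma$; (M2) for all $R>0$, $\alpha\in(\sigma,2]$, $\delta\in(0,1)$: $\ \sup_{|x|\le R}\int_{B_\delta}|z|^\alpha\,\nu_x(dz)\le c_2(R,\alpha)\,\delta^{\alpha-\sigma}$. Put $I_x(\phi,x)=\int_{\mathbb{R}^N}[\phi(x+z)-\phi(x)]\,\nu_x(dz)$, let $d_\Omega$ be the distance to $\partial\Omega$, and consider the equation $$-I_x(u,x)+b_0|Du(x)|^m=A\,(d_\Omega(x)^{-\theta}+1),\qquad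 x\in\Omega. \tag{P'}$$ A bounded Borel function $u:\mathbb{R}^N\to\mathbb{R}$ is a viscosity subsolution of (P') if it is upper semicontinuous in $\Omega$ and, whenever $x\in\Omega$, $\delta>0$, $\phi$ is $C^2$ in a neighbourhood of $\overline{B}_\delta(x)$ and $u-\phi$ has a maximum over $B_\delta(x)$ at $x$, then $$-\int_{B_\delta}[\phi(x+z)-\phi(x)]\,\nu_x(dz)-\int_{B_\delta^c}[u(x+z)-u(x)]\,\nu_x(dz)+b_0|D\phi(x)|^m\le A\,(d_\Omega(x)^{-\theta}+1).$$ Let $\Omega_\nu=\Omega\cup\bigcup_{x\in\overline\Omega}(x+\operatorname{supp}\nu_x)$, $\operatorname{osc}_{S}u=\sup_S u-\inf_S u$, and $$\gamma_0=\min\{(m-\sigma)/m,\ (m-\theta)/m\}.$$ Then for every $\gamma\in(0,\gamma_0)$, every bounded viscosity subsolution $u$ of (P') is locally $\gamma$-Hölder continuous in $\Omega$; and if $\partial\Omega$ is of class $C^{1,1}$, then $u$ is $\gamma$-Hölder continuous in $\Omega$ and extends to a $\gamma$-Hölder continuous function on $\overline\Omega$. The seminorms depend only on the data and on an upper bound for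 $\operatorname{osc}_{\Omega_\nu}u$. Precisely, given $N,\Omega,\sigma,m,\theta,b_0,A,\gamma$, the functions $c_1,c_2$ and a number $K$, there are a constant $C$, radii $\rho(x_0)>0$ $(x_0\in\Omega)$ and constants $C'(S)$ ($S\subset\Omega$ compact) such that, for all families $\{\nu_x\}$ satisfying (M1)–(M2) with $c_1,c_2$ and all bounded viscosity subsolutions $u$ of (P') with $\operatorname{osc}_{\Omega_\nu}u\le K$: for each $x_0\in\Omega$, $u$ is $\gamma$-Hölder on $B_{\rho(x_0)}(x_0)$ with constant $C$; $u$ is $\gamma$-Hölder on each compact $S\subset\Omega$ with constant $C'(S)$; and, if $\partial\Omega$ is $C^{1,1}$, $u$ is $\gamma$-Hölder on $\Omega$, and has an extension to $\overline\Omega$ that is $\gamma$-Hölder, both with constant $C$. -/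

import Mathlib

open MeasureTheory Metric Set
open scoped NNReal ENNReal

noncomputable section

/-- The growth function `h_{α,σ}(δ)`, for `δ > 0`. -/
def levyGrowth (α σ δ : ℝ) : ℝ :=
  if α < σ then δ ^ (α - σ) else if α = σ then |Real.log δ| + 1 else 1

/-- Condition (M1) of order `σ` for the family `ν`, with constants `c R α`:
`sup_{|x| ≤ R} ∫_{B_δᶜ} min {1, |z|^α} ν_x(dz) ≤ c R α * h_{α,σ}(δ)` for all `R > 0`,
`α ∈ [0,2]`, `δ > 0`. -/
def LevyM1 {N : ℕ} (σ : ℝ) (c : ℝ → ℝ → ℝ)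
    (ν : EuclideanSpace ℝ (Fin N) → Measure (EuclideanSpace ℝ (Fin N))) : Prop :=
  ∀ R : ℝ, 0 < R → ∀ α ∈ Icc (0 : ℝ) 2, ∀ δ : ℝ, 0 < δ →
    ∀ x ∈ closedBall (0 : EuclideanSpace ℝ (Fin N)) R,
      ∫⁻ z in (ball (0 : EuclideanSpace ℝ (Fin N)) δ)ᶜ, ENNReal.ofReal (min 1 (‖z‖ ^ α)) ∂(ν x)
        ≤ ENNReal.ofReal (c R α * levyGrowth α σ δ)

/-- Condition (M2) of order `σ` for the family `ν`, with constants `c R α`: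
`sup_{|x| ≤ R} ∫_{B_δ} |z|^α ν_x(dz) ≤ c R α * δ^(α-σ)` for all `R > 0`, `α ∈ (σ,2]`,
`δ ∈ (0,1)`. -/
def LevyM2 {N : ℕ} (σ : ℝ) (c : ℝ → ℝ → ℝ)
    (ν : EuclideanSpace ℝ (Fin N) → Measure (EuclideanSpace ℝ (Fin N))) : Prop :=
  ∀ R : ℝ, 0 < R → ∀ α ∈ Ioc σ 2, ∀ δ ∈ Ioo (0 : ℝ) 1,
    ∀ x ∈ closedBall (0 : EuclideanSpace ℝ (Fin N)) R,
      ∫⁻ z in ball (0 : EuclideanSpace ℝ (Fin N)) δ, ENNReal.ofReal (‖z‖ ^ α) ∂(ν x)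
        ≤ ENNReal.ofReal (c R α * δ ^ (α - σ))

/-- The nonlocal operator restricted to jumps in `S`, in its form without first order correction
(the one for orders `σ < 1`): `I_ξ[S](φ, x) = ∫_S [φ(x + z) - φ(x)] ν_ξ(dz)`. -/
def nonlocalOp {N : ℕ} (ν : EuclideanSpace ℝ (Fin N) → Measure (EuclideanSpace ℝ (Fin N)))
    (ξ : EuclideanSpace ℝ (Fin N)) (S : Set (EuclideanSpace ℝ (Fin N)))
    (φ : EuclideanSpace ℝ (Fin N) → ℝ) (x : EuclideanSpace ℝ (Fin N)) : ℝ :=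
  ∫ z in S, (φ (x + z) - φ x) ∂(ν ξ)

/-- `Ω_ν = Ω ∪ ⋃_{x ∈ closure Ω} (x + supp ν_x)`, the set reachable from `Ω` through `ν`. -/
def reachableSet {N : ℕ} (Ω : Set (EuclideanSpace ℝ (Fin N)))
    (ν : EuclideanSpace ℝ (Fin N) → Measure (EuclideanSpace ℝ (Fin N))) :
    Set (EuclideanSpace ℝ (Fin N)) :=
  Ω ∪ ⋃ x ∈ closure Ω, (fun z => x + z) '' (ν x).support

/-- The oscillation `sup_S u - inf_S u` of a (bounded) function `u` on `S`. -/
def oscillationOn {N : ℕ} (S : Set (EuclideanSpace ℝ (Fin N)))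
    (u : EuclideanSpace ℝ (Fin N) → ℝ) : ℝ :=
  sSup (u '' S) - sInf (u '' S)

/-- Viscosity subsolutions `u : ℝ^N → ℝ` in `Ω` of
`-I_x(u, x) + b₀ |Du(x)|^m = A (d_Ω(x)^(-θ) + 1)`, where `d_Ω` is the distance to `∂Ω`:
`u` is upper semicontinuous in `Ω`, and whenever `φ` is `C²` around the closed `δ`-ball about
`x ∈ Ω` and `u - φ` has a maximum over the `δ`-ball at `x`, the inequality holds at `x` with `φ` in
the gradient and in the small jumps `|z| < δ`, and with `u` in the remaining jumps. -/
structure IsViscositySubsolution {N : ℕ} (Ω : Set (EuclideanSpace ℝ (Fin N)))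
    (ν : EuclideanSpace ℝ (Fin N) → Measure (EuclideanSpace ℝ (Fin N)))
    (m θ b₀ A : ℝ) (u : EuclideanSpace ℝ (Fin N) → ℝ) : Prop where
  usc : UpperSemicontinuousOn u Ω
  test : ∀ x ∈ Ω, ∀ δ : ℝ, 0 < δ → ∀ φ : EuclideanSpace ℝ (Fin N) → ℝ,
    (∀ y ∈ closedBall x δ, ContDiffAt ℝ 2 φ y) →
    (∀ y ∈ ball x δ, u y - φ y ≤ u x - φ x) →
      -(nonlocalOp ν x (ball 0 δ) φ x + nonlocalOp ν x (ball 0 δ)ᶜ u x)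
          + b₀ * ‖gradient φ x‖ ^ m
        ≤ A * (infDist x (frontier Ω) ^ (-θ) + 1)

/-- `Ω` has a `C^{1,1}` boundary: near each boundary point, in the direction of a suitable unit
vector `e`, the set `Ω` is the strict epigraph of a function `g` of the component orthogonal to `e`,
where `g` is differentiable with Lipschitz derivative. -/
def HasC11Boundary {N : ℕ} (Ω : Set (EuclideanSpace ℝ (Fin N))) : Prop :=
  ∀ p ∈ frontier Ω, ∃ r : ℝ, 0 < r ∧ ∃ e : EuclideanSpace ℝ (Fin N), ‖e‖ = 1 ∧
    ∃ g : EuclideanSpace ℝ (Fin N) → ℝ, Differentiable ℝ g ∧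
      (∃ L : ℝ≥0, LipschitzWith L (fderiv ℝ g)) ∧
      ∀ x ∈ ball p r, x ∈ Ω ↔ g (x - inner ℝ e x • e) < inner ℝ e x

end

/-! The gradient term is coercive enough to beat the nonlocal term. On a ball `ball x R` inside `Ω`,
compare `u - u x` with the barrier `Φ y = L R |y-x|^γ / (R - |y-x|)`. If `u - u x` exceeds `Φ`
somewhere, then `u - Φ` has a maximum over the ball at some `y ≠ x` with `Φ y ≤ K`
(`exists_isMaxOn_sub_radialBarrier`). Let `μ` be the distance from `y` to the singularities of `Φ`,
namely the centre and the sphere. Splitting the jumps at `μ/2`, the nonlocal terms are at most a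
constant times `K μ^(-σ)` and the right-hand side is at most `A (μ^(-θ) + 1)`, while `|DΦ y|^m ≥ (γ
L)^m μ^(-(1-γ)m)`. Since `γ < γ₀` means that `σ` and `θ` lie below `(1-γ) m`, and `μ ≤ 1`, the
gradient power dominates; this bounds `L` by the data (`IsViscositySubsolution.slope_le`), so a
larger `L` is contradictory.

The resulting constant does not depend on `R`. This scale invariance carries the bound up to the
boundary: chains of balls shrinking geometrically along the axis of an interior cone give a
convergent series, and two nearby points are joined through the axes of parallel cones. Distant
points are handled by the oscillation bound. -/

/-- A radial barrier about `x`, comparable to `L |y - x| ^ γ` on the half ball and infinite on the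
boundary of the ball of radius `R`. -/
noncomputable def radialBarrier {E : Type*} [NormedAddCommGroup E] (x : E) (R L γ : ℝ) (y : E) : ℝ :=
  L * R * ‖y - x‖ ^ γ / (R - ‖y - x‖)

/-! ### Size and increments of the barrier -/

section Barrier

variable {E : Type*} [NormedAddCommGroup E] {x y z : E} {R L γ : ℝ}

lemma radialBarrier_self (hγ : 0 < γ) : radialBarrier x R L γ x = 0 := by
  simp [radialBarrier, Real.zero_rpow hγ.ne']

lemma radialBarrier_nonneg (hR : 0 < R) (hL : 0 < L) (hy : ‖y - x‖ < R) :
    0 ≤ radialBarrier x R L γ y :=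
  div_nonneg (by positivity) (by linarith)

lemma radialBarrier_le (hR : 0 < R) (hL : 0 < L) (hy : ‖y - x‖ ≤ R / 2) :
    radialBarrier x R L γ y ≤ 2 * L * ‖y - x‖ ^ γ := by
  have h0 := norm_nonneg (y - x)
  have h1 : 0 ≤ L * ‖y - x‖ ^ γ := by positivity
  rw [radialBarrier, div_le_iff₀ (by linarith)]
  nlinarith

lemma continuousOn_radialBarrier (hγ : 0 < γ) :
    ContinuousOn (radialBarrier x R L γ) (ball x R) := by
  unfold radialBarrier
  refine ContinuousOn.div ?_ (by fun_prop) ?_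
  · refine continuousOn_const.mul (Continuous.continuousOn ?_)
    exact (continuous_id.sub continuous_const).norm.rpow_const fun _ => Or.inr hγ.le
  · intro y hy
    rw [mem_ball_iff_norm] at hy
    linarith

/-- Increment bound for the barrier on a ball of radius comparable to the distance `μ` to its
singularities. -/
lemma radialBarrier_add_sub_le (hR : 0 < R) (hL : 0 < L) (hγ : 0 < γ) (hγ1 : γ ≤ 1) {μ : ℝ}
    (hμ : 0 < μ) (h1 : μ ≤ ‖y - x‖) (h2 : μ ≤ R - ‖y - x‖) (hz : ‖z‖ < μ / 2) :
    radialBarrier x R L γ (y + z) - radialBarrier x R L γ y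
      ≤ 4 * radialBarrier x R L γ y / μ * ‖z‖ := by
  have hΦ : 0 ≤ radialBarrier x R L γ y := radialBarrier_nonneg hR hL (by linarith)
  set r := ‖y - x‖ with hr
  set t := ‖z‖ with ht
  have ht0 : 0 ≤ t := norm_nonneg z
  have htri : ‖y + z - x‖ ≤ r + t := by
    rw [show y + z - x = (y - x) + z by abel]; exact norm_add_le _ _
  have hr0 : 0 < r := by linarith
  have hstep : ‖y + z - x‖ ^ γ ≤ r ^ γ * (1 + t / μ) := by
    calc ‖y + z - x‖ ^ γ ≤ (r + t) ^ γ := Real.rpow_le_rpow (norm_nonneg _) htri hγ.le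
      _ = r ^ γ * (1 + t / r) ^ γ := by
        rw [← Real.mul_rpow hr0.le (by positivity)]; congr 1; field_simp
      _ ≤ r ^ γ * (1 + t / r) := by
        gcongr
        exact Real.rpow_le_self_of_one_le (le_add_of_nonneg_right (by positivity)) hγ1
      _ ≤ r ^ γ * (1 + t / μ) := by gcongr
  have hs : 0 < R - r := by linarith
  have hst : 0 < R - r - t := by linarith
  -- Here `R - r - t ≥ μ/2`, because `t < μ/2`.
  have hden : 1 / (R - ‖y + z - x‖) ≤ 1 / (R - r) * (1 + 2 * (t / μ)) := by
    calc 1 / (R - ‖y + z - x‖) ≤ 1 / (R - r - t) := by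
          apply one_div_le_one_div_of_le hst; linarith
      _ = 1 / (R - r) * (1 + t / (R - r - t)) := by field_simp; ring
      _ ≤ 1 / (R - r) * (1 + 2 * (t / μ)) := by
        gcongr
        rw [show 2 * (t / μ) = t / (μ / 2) by field_simp]
        gcongr
        linarith
  have hq : t / μ ≤ 1 / 2 := by rw [div_le_iff₀ hμ]; linarith
  have hq0 : 0 ≤ t / μ := by positivity
  have hmain : radialBarrier x R L γ (y + z)
      ≤ radialBarrier x R L γ y * ((1 + t / μ) * (1 + 2 * (t / μ))) := by
    calc radialBarrier x R L γ (y + z)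
        = L * R * (‖y + z - x‖ ^ γ * (1 / (R - ‖y + z - x‖))) := by
          rw [radialBarrier]; ring
      _ ≤ L * R * ((r ^ γ * (1 + t / μ)) * (1 / (R - r) * (1 + 2 * (t / μ)))) := by
        gcongr
        exact one_div_nonneg.2 (by linarith)
      _ = _ := by rw [radialBarrier]; ring
  -- With `q = t/μ ≤ 1/2`, the term `2q²` of the product is at most `q`.
  have : radialBarrier x R L γ y * ((1 + t / μ) * (1 + 2 * (t / μ)))
      ≤ radialBarrier x R L γ y * (1 + 4 * (t / μ)) := by
    gcongr; nlinarith
  calc _ ≤ radialBarrier x R L γ y * (1 + 4 * (t / μ)) - radialBarrier x R L γ y := by linarith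
    _ = _ := by ring

lemma exists_radius_lt_radialBarrier (hR : 0 < R) (hL : 0 < L) (hγ : 0 < γ) {K : ℝ} (hK : 0 ≤ K) :
    ∃ R' ∈ Ioo 0 R, ∀ y, R' ≤ ‖y - x‖ → ‖y - x‖ < R → K < radialBarrier x R L γ y := by
  -- Within `ε` of the sphere the numerator is at least `L R (R/2)^γ` and the denominator at most
  -- `ε`, so the quotient is at least `K + 1`.
  set ε := min (R / 2) (L * R * (R / 2) ^ γ / (K + 1)) with hε
  have hε0 : 0 < ε := lt_min (by positivity) (by positivity)
  have hε1 : ε ≤ R / 2 := min_le_left _ _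
  have hε2 : ε * (K + 1) ≤ L * R * (R / 2) ^ γ := by
    rw [← le_div_iff₀ (by linarith)]; exact min_le_right _ _
  refine ⟨R - ε, ⟨by linarith, by linarith⟩, fun y h1 h2 => ?_⟩
  rw [radialBarrier, lt_div_iff₀ (by linarith)]
  have h3 : (R / 2) ^ γ ≤ ‖y - x‖ ^ γ := by gcongr; linarith
  have h4 : L * R * (R / 2) ^ γ ≤ L * R * ‖y - x‖ ^ γ := by gcongr
  nlinarith

end Barrier

/-! ### Smoothness and gradient of the barrier -/

section BarrierCalculus

variable {E : Type*} [NormedAddCommGroup E] [InnerProductSpace ℝ E] {x y : E} {R L γ : ℝ}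

lemma contDiffAt_radialBarrier (hy : y ≠ x) (hyR : ‖y - x‖ < R) :
    ContDiffAt ℝ 2 (radialBarrier x R L γ) y := by
  have h0 : y - x ≠ 0 := sub_ne_zero.2 hy
  have hn : ContDiffAt ℝ 2 (fun y => ‖y - x‖) y :=
    (contDiffAt_id.sub contDiffAt_const).norm ℝ h0
  unfold radialBarrier
  refine ContDiffAt.div ?_ (contDiffAt_const.sub hn) (by linarith)
  exact contDiffAt_const.mul (hn.rpow_const_of_ne (norm_ne_zero_iff.2 h0))

/-- The radial derivative is a sum of two nonnegative terms, one from the power and one from the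
blow-up factor; whichever singularity is nearer, its term alone gives the bound. -/
lemma le_norm_gradient_radialBarrier [CompleteSpace E] (hR : 0 < R) (hL : 0 < L) (hγ : 0 < γ)
    (hγ1 : γ ≤ 1) {μ : ℝ} (hμ : μ = min ‖y - x‖ (R - ‖y - x‖)) (hμ0 : 0 < μ) :
    γ * L * (μ ^ γ / μ) ≤ ‖gradient (radialBarrier x R L γ) y‖ := by
  have h1 : 0 < ‖y - x‖ := hμ0.trans_le (hμ ▸ min_le_left _ _)
  have h2 : 0 < R - ‖y - x‖ := hμ0.trans_le (hμ ▸ min_le_right _ _)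
  have hyx : y ≠ x := by rintro rfl; simp at h1
  set r := ‖y - x‖ with hr
  set v : E := r⁻¹ • (y - x) with hv
  have hvn : ‖v‖ = 1 := by 
    rw [hv, norm_smul, norm_inv, Real.norm_of_nonneg h1.le, ← hr, inv_mul_cancel₀ h1.ne']
  have hdiff := (contDiffAt_radialBarrier (L := L) (γ := γ) hyx (by linarith : ‖y - x‖ < R)).differentiableAt
    (by norm_num)
  have hline : HasDerivAt (fun t : ℝ => y + t • v) v 0 := by
    simpa using ((hasDerivAt_id (0 : ℝ)).smul_const v).const_add y
  have hcomp : HasDerivAt (radialBarrier x R L γ ∘ fun t : ℝ => y + t • v)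
      (fderiv ℝ (radialBarrier x R L γ) y v) 0 := by
    have h := hdiff.hasFDerivAt
    rw [show y = y + (0 : ℝ) • v by simp] at h
    simpa using h.comp_hasDerivAt (0 : ℝ) hline
  have hexp : HasDerivAt (fun t : ℝ => L * R * (r + t) ^ γ / (R - (r + t)))
      (((L * R * (γ * r ^ (γ - 1))) * (R - r) + L * R * r ^ γ) / (R - r) ^ 2) 0 := by
    have ha : HasDerivAt (fun t : ℝ => r + t) 1 0 := (hasDerivAt_id (0 : ℝ)).const_add r
    have hb := ((ha.rpow_const (p := γ) (Or.inl (by simpa using h1.ne'))).const_mul (L * R)).div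
      (ha.const_sub R) (by simpa using h2.ne')
    convert! hb using 1
    simp only [add_zero]
    ring
  have heq : (radialBarrier x R L γ ∘ fun t : ℝ => y + t • v)
      =ᶠ[nhds 0] fun t : ℝ => L * R * (r + t) ^ γ / (R - (r + t)) := by
    filter_upwards [Ioi_mem_nhds (show -r < 0 by linarith)] with t ht
    have hrt : 0 < r + t := by rw [mem_Ioi] at ht; linarith
    have : ‖y + t • v - x‖ = r + t := by
      have hvec : y + t • v - x = (r + t) • v := by
        have : y - x = r • v := by rw [hv, smul_smul, mul_inv_cancel₀ h1.ne', one_smul]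
        rw [add_smul, ← this]; abel
      rw [hvec, norm_smul, hvn, mul_one, Real.norm_of_nonneg hrt.le]
    simp only [Function.comp, radialBarrier, this]
  have hval := (hcomp.congr_of_eventuallyEq heq.symm).unique hexp
  have hgrad : ‖gradient (radialBarrier x R L γ) y‖ = ‖fderiv ℝ (radialBarrier x R L γ) y‖ := by
    rw [gradient, LinearIsometryEquiv.norm_map]
  have hle : fderiv ℝ (radialBarrier x R L γ) y v ≤ ‖fderiv ℝ (radialBarrier x R L γ) y‖ := by
    have := (fderiv ℝ (radialBarrier x R L γ) y).le_opNorm v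
    rw [hvn, mul_one] at this
    exact (le_abs_self _).trans this
  rw [hgrad]
  refine le_trans ?_ hle
  rw [hval, Real.rpow_sub_one h1.ne']
  have hrγ : 0 < r ^ γ := by positivity
  have hsplit : ((L * R * (γ * (r ^ γ / r))) * (R - r) + L * R * r ^ γ) / (R - r) ^ 2
      = L * (R / (R - r)) * γ * (r ^ γ / r) + L * r ^ γ * (R / (R - r)) / (R - r) := by
    field_simp
  have hRr : 1 ≤ R / (R - r) := by rw [le_div_iff₀ h2]; linarith
  rw [hsplit]
  rcases le_total r (R - r) with h | h
  · have hμr : μ = r := by rw [hμ, min_eq_left h]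
    rw [hμr]
    have e1 : 0 ≤ L * r ^ γ * (R / (R - r)) / (R - r) := by positivity
    have e2 : γ * L * (r ^ γ / r) ≤ L * (R / (R - r)) * γ * (r ^ γ / r) := by
      have := mul_le_mul_of_nonneg_left hRr (show 0 ≤ γ * L * (r ^ γ / r) by positivity)
      linarith
    linarith
  · have hμr : μ = R - r := by rw [hμ, min_eq_right h]
    rw [← hμr] at hRr ⊢
    have e1 : 0 ≤ L * (R / μ) * γ * (r ^ γ / r) := by positivity
    have e2 : γ * L * (μ ^ γ / μ) ≤ L * r ^ γ * (R / μ) / μ := by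
      have e3 : μ ^ γ ≤ r ^ γ := by gcongr; linarith
      calc γ * L * (μ ^ γ / μ) ≤ 1 * L * (r ^ γ / μ) := by gcongr
        _ = L * r ^ γ * 1 / μ := by ring
        _ ≤ _ := by gcongr
    linarith

end BarrierCalculus

/-! ### Bounds for the small and large jumps -/

section LevyIntegrals

variable {N : ℕ} {σ : ℝ} {c : ℝ → ℝ → ℝ}
  {ν : EuclideanSpace ℝ (Fin N) → Measure (EuclideanSpace ℝ (Fin N))}

/-- A non-integrable `f` has Bochner integral zero, which `0 ≤ g` covers. Hence one-sided bounds on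
the jumps suffice. -/
lemma integral_le_of_le_of_nonneg {α : Type*} [MeasurableSpace α] {μ : Measure α} {f g : α → ℝ}
    (hg : Integrable g μ) (hg0 : 0 ≤ᵐ[μ] g) (hfg : f ≤ᵐ[μ] g) : ∫ a, f a ∂μ ≤ ∫ a, g a ∂μ := by
  by_cases hf : Integrable f μ
  · exact integral_mono_ae hf hg hfg
  · rw [integral_undef hf]; exact integral_nonneg_of_ae hg0

lemma LevyM2.nonlocalOp_ball_le (hν : LevyM2 σ c ν) (hσ : σ ∈ Ioo (0 : ℝ) 1) {R δ B : ℝ} (hR : 0 < R)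
    (hδ : δ ∈ Ioo (0 : ℝ) 1) (hB : 0 ≤ B) {y : EuclideanSpace ℝ (Fin N)} (hy : ‖y‖ ≤ R)
    {φ : EuclideanSpace ℝ (Fin N) → ℝ} (hφ : ∀ z, ‖z‖ < δ → φ (y + z) - φ y ≤ B * ‖z‖) :
    nonlocalOp ν y (ball 0 δ) φ y ≤ B * (max (c R 1) 0 * δ ^ (1 - σ)) := by
  -- The exponent `α = 1` is admissible since `σ < 1`. The bounds use `max (c R α) 0` because `c`
  -- carries no sign.
  have h := hν R hR 1 ⟨hσ.2, by norm_num⟩ δ hδ y (by simpa using hy)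
  simp only [Real.rpow_one] at h
  have hmeas : AEStronglyMeasurable (fun z : EuclideanSpace ℝ (Fin N) => ‖z‖)
      ((ν y).restrict (ball 0 δ)) := continuous_norm.aestronglyMeasurable
  have hint : Integrable (fun z : EuclideanSpace ℝ (Fin N) => ‖z‖) ((ν y).restrict (ball 0 δ)) := by
    refine ⟨hmeas, ?_⟩
    rw [hasFiniteIntegral_iff_ofReal (ae_of_all _ fun z => norm_nonneg z)]
    exact h.trans_lt ENNReal.ofReal_lt_top
  have hval : ∫ z in ball (0 : EuclideanSpace ℝ (Fin N)) δ, ‖z‖ ∂(ν y)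
      ≤ max (c R 1) 0 * δ ^ (1 - σ) := by
    have hp : 0 ≤ δ ^ (1 - σ) := Real.rpow_nonneg hδ.1.le _
    rw [integral_eq_lintegral_of_nonneg_ae (ae_of_all _ fun z => norm_nonneg z) hmeas]
    refine ENNReal.toReal_le_of_le_ofReal (by positivity) (h.trans (ENNReal.ofReal_le_ofReal ?_))
    gcongr
    exact le_max_left _ _
  calc nonlocalOp ν y (ball 0 δ) φ y ≤ ∫ z in ball (0 : EuclideanSpace ℝ (Fin N)) δ, B * ‖z‖ ∂(ν y) := by
        refine integral_le_of_le_of_nonneg (hint.const_mul B) (ae_of_all _ fun z => by positivity) ?_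
        filter_upwards [ae_restrict_mem measurableSet_ball] with z hz
        exact hφ z (by simpa using hz)
    _ = B * ∫ z in ball (0 : EuclideanSpace ℝ (Fin N)) δ, ‖z‖ ∂(ν y) := integral_const_mul _ _
    _ ≤ _ := by gcongr

lemma LevyM1.nonlocalOp_compl_ball_le (hν : LevyM1 σ c ν) (hσ : 0 < σ) {R δ B : ℝ} (hR : 0 < R)
    (hδ : 0 < δ) (hB : 0 ≤ B) {y : EuclideanSpace ℝ (Fin N)} (hy : ‖y‖ ≤ R)
    {u : EuclideanSpace ℝ (Fin N) → ℝ} (hu : ∀ᵐ z ∂(ν y), u (y + z) - u y ≤ B) :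
    nonlocalOp ν y (ball 0 δ)ᶜ u y ≤ B * (max (c R 0) 0 * δ ^ (-σ)) := by
  -- For `α = 0` the integrand is one, so this bounds the mass of the large jumps.
  have h := hν R hR 0 ⟨le_rfl, by norm_num⟩ δ hδ y (by simpa using hy)
  simp only [Real.rpow_zero, min_self, ENNReal.ofReal_one, setLIntegral_one, levyGrowth, if_pos hσ,
    zero_sub] at h
  have hfin : (ν y) (ball 0 δ)ᶜ < ∞ := h.trans_lt ENNReal.ofReal_lt_top
  have hval : (ν y).real (ball 0 δ)ᶜ ≤ max (c R 0) 0 * δ ^ (-σ) := by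
    have hp : 0 ≤ δ ^ (-σ) := Real.rpow_nonneg hδ.le _
    refine ENNReal.toReal_le_of_le_ofReal (by positivity) (h.trans (ENNReal.ofReal_le_ofReal ?_))
    gcongr
    exact le_max_left _ _
  calc nonlocalOp ν y (ball 0 δ)ᶜ u y
      ≤ ∫ _ in (ball (0 : EuclideanSpace ℝ (Fin N)) δ)ᶜ, B ∂(ν y) :=
        integral_le_of_le_of_nonneg (integrableOn_const hfin.ne) (ae_of_all _ fun _ => hB)
          (ae_restrict_of_ae hu)
    _ = B * (ν y).real (ball 0 δ)ᶜ := by rw [setIntegral_const, smul_eq_mul, mul_comm]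
    _ ≤ _ := by gcongr

end LevyIntegrals

/-! ### Oscillation and distance to the boundary -/

section Oscillation

variable {N : ℕ} {Ω S : Set (EuclideanSpace ℝ (Fin N))} {u : EuclideanSpace ℝ (Fin N) → ℝ}

lemma sub_le_of_oscillationOn_le {K M : ℝ} (hu : ∀ x, |u x| ≤ M) (hK : oscillationOn S u ≤ K)
    {x y : EuclideanSpace ℝ (Fin N)} (hx : x ∈ S) (hy : y ∈ S) : u y - u x ≤ K := by
  have h1 : u y ≤ sSup (u '' S) :=
    le_csSup ⟨M, by rintro _ ⟨z, -, rfl⟩; exact (abs_le.1 (hu z)).2⟩ (mem_image_of_mem u hy)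
  have h2 : sInf (u '' S) ≤ u x :=
    csInf_le ⟨-M, by rintro _ ⟨z, -, rfl⟩; exact (abs_le.1 (hu z)).1⟩ (mem_image_of_mem u hx)
  unfold oscillationOn at hK
  linarith

lemma infDist_frontier_rpow_neg_le {E : Type*} [PseudoMetricSpace E] {U : Set E} (hU : IsOpen U)
    {y : E} {μ θ : ℝ} (hμ : 0 < μ) (hμ1 : μ ≤ 1) (hθ : 0 ≤ θ) (hb : ball y μ ⊆ U) :
    infDist y (frontier U) ^ (-θ) ≤ μ ^ (-θ) := by
  rcases (frontier U).eq_empty_or_nonempty with h | h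
  -- With empty frontier the distance is zero by convention, and `0 ^ (-θ)` is 0 or 1.
  · rw [h, infDist_empty]
    refine le_trans ?_ (Real.one_le_rpow_of_pos_of_le_one_of_nonpos hμ hμ1 (by linarith))
    exact Real.zero_rpow_le_one _
  · refine Real.rpow_le_rpow_of_nonpos hμ ((le_infDist h).2 fun z hz => ?_) (by linarith)
    by_contra! hlt
    rw [hU.frontier_eq] at hz
    exact hz.2 (hb (by rwa [mem_ball']))

end Oscillation

/-! ### The maximum point and the viscosity inequality -/

section LocalEstimate

variable {N : ℕ} {Ω : Set (EuclideanSpace ℝ (Fin N))}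
  {ν : EuclideanSpace ℝ (Fin N) → Measure (EuclideanSpace ℝ (Fin N))}
  {u : EuclideanSpace ℝ (Fin N) → ℝ}

/-- If `u` grows faster than the barrier, then `u - radialBarrier` has a maximum over the ball away
from its centre. -/
lemma exists_isMaxOn_sub_radialBarrier {x : EuclideanSpace ℝ (Fin N)} {R L γ K : ℝ} (hR : 0 < R)
    (hL : 0 < L) (hγ : 0 < γ) (hK : 0 ≤ K) (husc : UpperSemicontinuousOn u (ball x R))
    (hosc : ∀ y ∈ ball x R, u y - u x ≤ K) {y₀ : EuclideanSpace ℝ (Fin N)} (hy₀ : y₀ ∈ ball x R)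
    (h : radialBarrier x R L γ y₀ < u y₀ - u x) :
    ∃ y ∈ ball x R, y ≠ x ∧ radialBarrier x R L γ y ≤ K ∧
      ∀ w ∈ ball x R, u w - radialBarrier x R L γ w ≤ u y - radialBarrier x R L γ y := by
  obtain ⟨R', ⟨hR'0, hR'R⟩, hR'⟩ := exists_radius_lt_radialBarrier (x := x) hR hL hγ hK
  have hsub : closedBall x R' ⊆ ball x R := closedBall_subset_ball hR'R
  have husc' : UpperSemicontinuousOn (fun w => u w + -radialBarrier x R L γ w) (closedBall x R') :=
    UpperSemicontinuousOn.add (fun w hw => (husc w (hsub hw)).mono hsub)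
      ((continuousOn_radialBarrier hγ).mono hsub).neg.upperSemicontinuousOn
  obtain ⟨y, hy, hmax⟩ := husc'.exists_isMaxOn ⟨x, mem_closedBall_self hR'0.le⟩
    (isCompact_closedBall x R')
  -- Beyond radius `R'` the barrier exceeds the oscillation bound, so a maximum over the compact
  -- ball is one over the open ball.
  have hout : ∀ w ∈ ball x R, w ∉ closedBall x R' → u w - radialBarrier x R L γ w < u x := by
    intro w hw hw'
    rw [mem_closedBall_iff_norm, not_le] at hw'
    have h1 := hR' w hw'.le (mem_ball_iff_norm.1 hw)
    have h2 := hosc w hw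
    linarith
  have hin : ∀ w ∈ closedBall x R',
      u w - radialBarrier x R L γ w ≤ u y - radialBarrier x R L γ y := by
    intro w hw
    have : u w + -radialBarrier x R L γ w ≤ u y + -radialBarrier x R L γ y := hmax hw
    linarith
  have hbig : u x < u y - radialBarrier x R L γ y := by
    have h3 : y₀ ∈ closedBall x R' := by
      by_contra hc
      have := hout y₀ hy₀ hc
      linarith
    have := hin y₀ h3
    linarith
  refine ⟨y, hsub hy, ?_, ?_, fun w hw => ?_⟩
  · rintro rfl
    rw [radialBarrier_self hγ] at hbig
    linarith
  · have := hosc y (hsub hy)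
    linarith
  · by_cases hw' : w ∈ closedBall x R'
    · exact hin w hw'
    · have := hout w hw hw'
      linarith

/-- The test inequality for the barrier bounds its slope. -/
lemma IsViscositySubsolution.slope_le {σ m θ b₀ A γ L K R R₀ : ℝ} {c₁ c₂ : ℝ → ℝ → ℝ}
    (hu : IsViscositySubsolution Ω ν m θ b₀ A u) (hΩ : IsOpen Ω) (hR₀ : 0 < R₀)
    (hΩR₀ : ∀ y ∈ Ω, ‖y‖ ≤ R₀)
    (hν₁ : LevyM1 σ c₁ ν) (hν₂ : LevyM2 σ c₂ ν) (hσ : σ ∈ Ioo (0 : ℝ) 1) (hm : 0 < m)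
    (hθ : 0 ≤ θ) (hb₀ : 0 < b₀) (hA : 0 < A) (hγ : 0 < γ) (hγ1 : γ ≤ 1)
    (hκσ : σ ≤ (1 - γ) * m) (hκθ : θ ≤ (1 - γ) * m) (hL : 0 < L) (hK : 0 ≤ K)
    (hjump : ∀ y ∈ Ω, ∀ᵐ z ∂(ν y), u (y + z) - u y ≤ K)
    {x y : EuclideanSpace ℝ (Fin N)} (hR : 0 < R) (hR1 : R ≤ 1) (hball : ball x R ⊆ Ω)
    (hy : y ∈ ball x R) (hyx : y ≠ x) (hΦK : radialBarrier x R L γ y ≤ K)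
    (hmax : ∀ w ∈ ball x R, u w - radialBarrier x R L γ w ≤ u y - radialBarrier x R L γ y) :
    b₀ * (γ * L) ^ m ≤ 2 * A + 4 * K * max (c₂ R₀ 1) 0 + 2 * K * max (c₁ R₀ 0) 0 := by
  have hyR : ‖y - x‖ < R := mem_ball_iff_norm.1 hy
  have hr : 0 < ‖y - x‖ := norm_pos_iff.2 (sub_ne_zero.2 hyx)
  obtain ⟨μ, hμ⟩ : ∃ μ, μ = min ‖y - x‖ (R - ‖y - x‖) := ⟨_, rfl⟩
  have hμ0 : 0 < μ := hμ ▸ lt_min hr (by linarith)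
  have hμ1 : μ ≤ ‖y - x‖ := hμ ▸ min_le_left _ _
  have hμ2 : μ ≤ R - ‖y - x‖ := hμ ▸ min_le_right _ _
  have hμle : μ ≤ 1 := by linarith
  have hyΩ : y ∈ Ω := hball hy
  have hyn : ‖y‖ ≤ R₀ := hΩR₀ y hyΩ
  have hbμ : ball y μ ⊆ ball x R := by
    refine ball_subset_ball' ?_
    rw [dist_eq_norm]; linarith
  -- The radius `μ/2` keeps the closed test ball away from both singularities of the barrier.
  have htest := hu.test y hyΩ (μ / 2) (by linarith) (radialBarrier x R L γ)
    (fun w hw => by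
      have hw' : ‖w - y‖ ≤ μ / 2 := mem_closedBall_iff_norm.1 hw
      refine contDiffAt_radialBarrier ?_ ?_
      · rintro rfl
        rw [norm_sub_rev] at hw'
        linarith
      · exact mem_ball_iff_norm.1 (hbμ (mem_ball_iff_norm.2 (by linarith))))
    (fun w hw => hmax w (hbμ (ball_subset_ball (by linarith) hw)))
  have hsmall : nonlocalOp ν y (ball 0 (μ / 2)) (radialBarrier x R L γ) y
      ≤ 4 * K / μ * (max (c₂ R₀ 1) 0 * (μ / 2) ^ (1 - σ)) := by
    refine hν₂.nonlocalOp_ball_le hσ hR₀ ⟨by linarith, by linarith⟩ (by positivity) hyn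
      fun z hz => ?_
    refine (radialBarrier_add_sub_le hR hL hγ hγ1 hμ0 hμ1 hμ2 hz).trans ?_
    gcongr
  have hlarge : nonlocalOp ν y (ball 0 (μ / 2))ᶜ u y
      ≤ K * (max (c₁ R₀ 0) 0 * (μ / 2) ^ (-σ)) :=
    hν₁.nonlocalOp_compl_ball_le hσ.1 hR₀ (by linarith) hK hyn (hjump y hyΩ)
  have hgrad := le_norm_gradient_radialBarrier hR hL hγ hγ1 hμ hμ0
  have hdist := infDist_frontier_rpow_neg_le hΩ hμ0 hμle hθ (hbμ.trans hball)
  -- As `μ ≤ 1`, every term is compared with `μ^(-κ)`, the rate of the gradient term, which is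
  -- cancelled at the end.
  set κ := (1 - γ) * m with hκ
  have hmono : ∀ τ, τ ≤ κ → μ ^ (-τ) ≤ μ ^ (-κ) := fun τ hτ =>
    Real.rpow_le_rpow_of_exponent_ge hμ0 hμle (by linarith)
  have hone : 1 ≤ μ ^ (-κ) := by simpa using hmono 0 (hσ.1.le.trans hκσ)
  have hgm : (γ * L) ^ m * μ ^ (-κ) ≤ ‖gradient (radialBarrier x R L γ) y‖ ^ m := by
    have hpow : (γ * L) ^ m * μ ^ (-κ) = (γ * L * (μ ^ γ / μ)) ^ m := by
      rw [← Real.rpow_sub_one hμ0.ne', Real.mul_rpow (mul_nonneg hγ.le hL.le)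
        (Real.rpow_nonneg hμ0.le _), ← Real.rpow_mul hμ0.le, hκ]
      ring_nf
    rw [hpow]
    gcongr
  have hs1 : (1 / μ) * (μ / 2) ^ (1 - σ) ≤ μ ^ (-κ) := by
    refine le_trans ?_ (hmono σ hκσ)
    have : (μ / 2) ^ (1 - σ) ≤ μ ^ (1 - σ) :=
      Real.rpow_le_rpow (by linarith) (by linarith) (by linarith [hσ.2])
    calc (1 / μ) * (μ / 2) ^ (1 - σ) ≤ (1 / μ) * μ ^ (1 - σ) := by gcongr
      _ = μ ^ (-σ) := by
        rw [show -σ = (1 - σ) - 1 by ring, Real.rpow_sub_one hμ0.ne' (1 - σ)]; ring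
  have hs2 : (μ / 2) ^ (-σ) ≤ 2 * μ ^ (-κ) := by
    have h2 : (2 : ℝ) ^ σ ≤ 2 := Real.rpow_le_self_of_one_le (by norm_num) hσ.2.le
    calc (μ / 2) ^ (-σ) = 2 ^ σ * μ ^ (-σ) := by
          rw [Real.div_rpow hμ0.le (by norm_num), Real.rpow_neg (by norm_num : (0 : ℝ) ≤ 2)]
          field_simp
      _ ≤ 2 * μ ^ (-κ) := by
          have := hmono σ hκσ
          gcongr
  have hc1 : 0 ≤ max (c₁ R₀ 0) 0 := le_max_right _ _
  have hc2 : 0 ≤ max (c₂ R₀ 1) 0 := le_max_right _ _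
  have hP : 0 < μ ^ (-κ) := by positivity
  have t1 : b₀ * ((γ * L) ^ m * μ ^ (-κ)) ≤ b₀ * ‖gradient (radialBarrier x R L γ) y‖ ^ m := by
    gcongr
  have t2 : A * (infDist y (frontier Ω) ^ (-θ) + 1) ≤ A * (2 * μ ^ (-κ)) := by
    have := hmono θ hκθ
    gcongr
    linarith
  have t3 : 4 * K / μ * (max (c₂ R₀ 1) 0 * (μ / 2) ^ (1 - σ))
      ≤ 4 * K * max (c₂ R₀ 1) 0 * μ ^ (-κ) := by
    calc _ = 4 * K * max (c₂ R₀ 1) 0 * ((1 / μ) * (μ / 2) ^ (1 - σ)) := by ring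
      _ ≤ _ := by gcongr
  have t4 : K * (max (c₁ R₀ 0) 0 * (μ / 2) ^ (-σ)) ≤ 2 * K * max (c₁ R₀ 0) 0 * μ ^ (-κ) := by
    calc _ ≤ K * (max (c₁ R₀ 0) 0 * (2 * μ ^ (-κ))) := by gcongr
      _ = _ := by ring
  refine le_of_mul_le_mul_right ?_ hP
  linarith

end LocalEstimate

/-! ### Scale-invariant interior estimate -/

/-- `u` satisfies a scale invariant `γ`-Hölder bound from the centre of every ball inside `Ω` of
radius at most one. -/
def InteriorHolder {E : Type*} [PseudoMetricSpace E] (Ω : Set E) (D γ : ℝ) (u : E → ℝ) : Prop :=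
  ∀ x R, 0 < R → R ≤ 1 → ball x R ⊆ Ω → ∀ y, dist y x ≤ R / 4 → |u y - u x| ≤ D * dist y x ^ γ

/-- The reverse inequality is the one-sided bound centred at `y` on radius `R/2`; this costs the
passage from `R/2` to `R/4`. -/
lemma InteriorHolder.of_oneSided {E : Type*} [PseudoMetricSpace E] {Ω : Set E} {D γ : ℝ}
    {u : E → ℝ}
    (h : ∀ x R, 0 < R → R ≤ 1 → ball x R ⊆ Ω → ∀ y, dist y x ≤ R / 2 →
      u y - u x ≤ D * dist y x ^ γ) :
    InteriorHolder Ω D γ u := by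
  intro x R hR hR1 hb y hy
  rw [abs_le]
  constructor
  · have := h y (R / 2) (by linarith) (by linarith)
      ((ball_subset_ball' (by linarith)).trans hb) x (by rw [dist_comm]; linarith)
    rw [dist_comm x y] at this
    linarith
  · exact h x R hR hR1 hb y (by linarith)

/-- Interior Hölder estimate, with a constant depending only on the data. -/
theorem exists_interiorHolder {N : ℕ} {Ω : Set (EuclideanSpace ℝ (Fin N))} (hΩ : IsOpen Ω)
    (hΩ_bdd : Bornology.IsBounded Ω) {σ m θ b₀ A γ : ℝ} (hσ : σ ∈ Ioo (0 : ℝ) 1) (hm : 0 < m)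
    (hθ : 0 ≤ θ) (hb₀ : 0 < b₀) (hA : 0 < A) (hγ : 0 < γ) (hγ1 : γ ≤ 1)
    (hκσ : σ ≤ (1 - γ) * m) (hκθ : θ ≤ (1 - γ) * m) (c₁ c₂ : ℝ → ℝ → ℝ) (K : ℝ) :
    ∃ D : ℝ, 0 < D ∧
      ∀ ν : EuclideanSpace ℝ (Fin N) → Measure (EuclideanSpace ℝ (Fin N)),
        LevyM1 σ c₁ ν → LevyM2 σ c₂ ν → ∀ u : EuclideanSpace ℝ (Fin N) → ℝ,
          (∃ M : ℝ, ∀ x, |u x| ≤ M) → IsViscositySubsolution Ω ν m θ b₀ A u →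
          oscillationOn (reachableSet Ω ν) u ≤ K → InteriorHolder Ω D γ u := by
  obtain ⟨R₁, hR₁⟩ := hΩ_bdd.exists_norm_le
  set R₀ := max R₁ 1
  have hR₀ : 0 < R₀ := lt_max_of_lt_right one_pos
  have hΩR₀ : ∀ y ∈ Ω, ‖y‖ ≤ R₀ := fun y hy => (hR₁ y hy).trans (le_max_left _ _)
  set K' := max K 0
  have hK' : 0 ≤ K' := le_max_right _ _
  set T := 2 * A + 4 * K' * max (c₂ R₀ 1) 0 + 2 * K' * max (c₁ R₀ 0) 0 with hT
  have hT0 : 0 < T := by positivity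
  -- This `L` solves `b₀ (γ L)^m = T + 1`, exceeding by one the bound `T` of `slope_le`.
  set L := ((T + 1) / b₀) ^ (1 / m) / γ with hL
  have hL0 : 0 < L := by positivity
  have hLT : b₀ * (γ * L) ^ m = T + 1 := by
    rw [hL, mul_div_cancel₀ _ hγ.ne', ← Real.rpow_mul (by positivity), one_div_mul_cancel hm.ne',
      Real.rpow_one]
    field_simp
  refine ⟨2 * L, by positivity, fun ν hν₁ hν₂ u ⟨M, hM⟩ hu hK => .of_oneSided ?_⟩
  have hΩsub : Ω ⊆ reachableSet Ω ν := subset_union_left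
  have hjump : ∀ y ∈ Ω, ∀ᵐ z ∂(ν y), u (y + z) - u y ≤ K' := by
    intro y hy
    -- Almost every jump lies in the support of `ν y`, so it lands in `reachableSet Ω ν`, where the
    -- oscillation is controlled.
    filter_upwards [Measure.support_mem_ae (μ := ν y)] with z hz
    exact (sub_le_of_oscillationOn_le hM hK (hΩsub hy) (Or.inr (mem_biUnion (subset_closure hy)
      (mem_image_of_mem _ hz)))).trans (le_max_left _ _)
  intro x R hR hR1 hb y hy
  rw [dist_eq_norm] at hy ⊢
  have hyb : y ∈ ball x R := mem_ball_iff_norm.2 (by linarith)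
  refine le_trans ?_ (radialBarrier_le hR hL0 hy)
  by_contra! hlt
  obtain ⟨w, hw, hwx, hwK, hwmax⟩ := exists_isMaxOn_sub_radialBarrier hR hL0 hγ hK'
    (fun w hw => (hu.usc w (hb hw)).mono hb)
    (fun w hw => (sub_le_of_oscillationOn_le hM hK (hΩsub (hb (mem_ball_self hR)))
      (hΩsub (hb hw))).trans (le_max_left _ _)) hyb hlt
  have := hu.slope_le hΩ hR₀ hΩR₀ hν₁ hν₂ hσ hm hθ hb₀ hA hγ hγ1 hκσ hκθ hL0 hK' hjump hR hR1 hb hw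
    hwx hwK hwmax
  linarith

/-! ### Hölder functions and their extension -/

lemma holderOnWith_of_abs_sub_le {E : Type*} [PseudoMetricSpace E] {f : E → ℝ} {s : Set E}
    {C γ : ℝ≥0} (h : ∀ x ∈ s, ∀ y ∈ s, |f x - f y| ≤ C * dist x y ^ (γ : ℝ)) :
    HolderOnWith C γ f s := by
  intro x hx y hy
  rw [edist_dist, edist_dist, ENNReal.ofReal_rpow_of_nonneg dist_nonneg γ.coe_nonneg,
    ← ENNReal.ofReal_coe_nnreal, ← ENNReal.ofReal_mul C.coe_nonneg, Real.dist_eq]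
  exact ENNReal.ofReal_le_ofReal (h x hx y hy)

/-- McShane extension of a bounded Hölder function. -/
lemma exists_holder_extension {E : Type*} [PseudoMetricSpace E] {f : E → ℝ} {s : Set E}
    (hs : s.Nonempty) {C γ : ℝ≥0} (hγ : 0 < γ) (hγ1 : γ ≤ 1) {M : ℝ} (hM : ∀ x, |f x| ≤ M)
    (h : ∀ x ∈ s, ∀ y ∈ s, |f x - f y| ≤ C * dist x y ^ (γ : ℝ)) :
    ∃ v : E → ℝ, EqOn v f s ∧ ∀ t, HolderOnWith C γ v t := by
  have hγ' : (0 : ℝ) < γ := hγ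
  have hγ1' : (γ : ℝ) ≤ 1 := hγ1
  have : Nonempty s := hs.to_subtype
  have hbdd : ∀ y, BddBelow (range fun x : s => f x + C * dist (x : E) y ^ (γ : ℝ)) := by
    intro y
    refine ⟨-M, ?_⟩
    rintro _ ⟨x, rfl⟩
    have h1 := (abs_le.1 (hM x)).1
    have h2 : 0 ≤ (C : ℝ) * dist (x : E) y ^ (γ : ℝ) := by positivity
    simp only
    linarith
  have hone : ∀ y w, (⨅ x : s, (f x + C * dist (x : E) y ^ (γ : ℝ)))
      ≤ (⨅ x : s, (f x + C * dist (x : E) w ^ (γ : ℝ))) + C * dist y w ^ (γ : ℝ) := by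
    intro y w
    rw [← sub_le_iff_le_add]
    refine le_ciInf fun x => ?_
    rw [sub_le_iff_le_add]
    refine (ciInf_le (hbdd y) x).trans ?_
    -- For `γ ≤ 1` the power `dist ^ γ` still satisfies the triangle inequality.
    have h1 : dist (x : E) y ^ (γ : ℝ) ≤ dist (x : E) w ^ (γ : ℝ) + dist y w ^ (γ : ℝ) := by
      refine (Real.rpow_le_rpow dist_nonneg ?_ hγ'.le).trans
        (Real.rpow_add_le_add_rpow dist_nonneg dist_nonneg hγ'.le hγ1')
      rw [dist_comm y w]
      exact dist_triangle _ _ _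
    have := mul_le_mul_of_nonneg_left h1 C.coe_nonneg
    linarith
  refine ⟨fun y => ⨅ x : s, (f x + C * dist (x : E) y ^ (γ : ℝ)), fun y hy => ?_, fun t =>
    holderOnWith_of_abs_sub_le fun y _ w _ => ?_⟩
  · refine le_antisymm ?_ (le_ciInf fun x => ?_)
    · refine (ciInf_le (hbdd y) ⟨y, hy⟩).trans ?_
      simp [Real.zero_rpow hγ'.ne']
    · have := (abs_le.1 (h x x.2 y hy)).1
      linarith
  · rw [abs_le]
    have h1 := hone y w
    have h2 := hone w y
    rw [dist_comm w y] at h2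
    constructor <;> linarith

/-! ### From interior balls to cones -/

section InteriorHolder

variable {E : Type*} [NormedAddCommGroup E] {Ω : Set E} {D γ : ℝ} {u : E → ℝ}

lemma InteriorHolder.continuousAt (hu : InteriorHolder Ω D γ u) (hΩ : IsOpen Ω) (hγ : 0 < γ) {x : E}
    (hx : x ∈ Ω) : ContinuousAt u x := by
  obtain ⟨R, hR, hb⟩ := Metric.isOpen_iff.1 hΩ x hx
  have hR' : 0 < min R 1 := lt_min hR one_pos
  rw [ContinuousAt, tendsto_iff_dist_tendsto_zero]
  have hlim : Filter.Tendsto (fun y => D * dist y x ^ γ) (nhds x) (nhds 0) := by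
    have hc : Continuous fun y => D * dist y x ^ γ :=
      continuous_const.mul ((continuous_id.dist continuous_const).rpow_const fun _ => Or.inr hγ.le)
    simpa [Real.zero_rpow hγ.ne'] using hc.tendsto x
  refine squeeze_zero' (Filter.Eventually.of_forall fun _ => dist_nonneg) ?_ hlim
  filter_upwards [closedBall_mem_nhds x (show 0 < min R 1 / 4 by positivity)] with y hy
  exact hu x _ hR' (min_le_right _ _) ((ball_subset_ball (min_le_left _ _)).trans hb) y hy

lemma abs_sub_le_of_le_dist {K r : ℝ} (hr : 0 < r) (hγ : 0 < γ) {x y : E}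
    (hK : |u x - u y| ≤ K) (hxy : r ≤ dist x y) : |u x - u y| ≤ K / r ^ γ * dist x y ^ γ := by
  have hK0 : 0 ≤ K := (abs_nonneg _).trans hK
  have h1 : r ^ γ ≤ dist x y ^ γ := by gcongr
  have hrγ : 0 < r ^ γ := by positivity
  calc |u x - u y| ≤ K / r ^ γ * r ^ γ := by rwa [div_mul_cancel₀ _ hrγ.ne']
    _ ≤ _ := by gcongr

variable [NormedSpace ℝ E]

/-- A Hölder bound along the axis of an interior cone, up to its vertex. -/
lemma InteriorHolder.abs_sub_le_of_cone (hu : InteriorHolder Ω D γ u) (hΩ : IsOpen Ω) (hD : 0 < D)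
    (hγ : 0 < γ) {x e : E} (hx : x ∈ Ω) (he : ‖e‖ ≤ 1) {c h : ℝ} (hc : c ∈ Ioc (0 : ℝ) 1)
    (hh : h ∈ Ioc (0 : ℝ) 1) (hcone : ∀ t ∈ Ioc 0 h, ball (x + t • e) (c * t) ⊆ Ω) :
    |u (x + h • e) - u x| ≤ D * h ^ γ / (1 - (1 - c / 4) ^ γ) := by
  obtain ⟨hc0, hc1⟩ := hc
  obtain ⟨hh0, hh1⟩ := hh
  -- Moving from height `t` to `p t` covers at most a quarter of the radius `c t` of the ball at
  -- height `t`, so the interior bound applies at each step.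
  set p := 1 - c / 4 with hp
  have hp0 : 0 < p := by linarith
  have hp1 : p < 1 := by linarith
  have hpγ : p ^ γ < 1 := Real.rpow_lt_one hp0.le hp1 hγ
  have htend : Filter.Tendsto (fun n : ℕ => u (x + (h * p ^ n) • e)) Filter.atTop (nhds (u x)) := by
    refine (hu.continuousAt hΩ hγ hx).tendsto.comp ?_
    have h1 : Filter.Tendsto (fun n : ℕ => x + (h * p ^ n) • e) Filter.atTop
        (nhds (x + (h * 0) • e)) :=
      (((tendsto_pow_atTop_nhds_zero_of_lt_one hp0.le hp1).const_mul h).smul_const e).const_add x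
    simpa using h1
  have hstep : ∀ n : ℕ, dist (u (x + (h * p ^ n) • e)) (u (x + (h * p ^ (n + 1)) • e))
      ≤ D * h ^ γ * (p ^ γ) ^ n := by
    intro n
    set t := h * p ^ n with ht
    have ht0 : 0 < t := by positivity
    have hth : t ≤ h := mul_le_of_le_one_right hh0.le (pow_le_one₀ hp0.le hp1.le)
    have ht' : h * p ^ (n + 1) = t - c / 4 * t := by rw [ht, pow_succ, hp]; ring
    have hdist : dist (x + (h * p ^ (n + 1)) • e) (x + t • e) ≤ c * t / 4 := by
      rw [ht', dist_add_left, dist_eq_norm, ← sub_smul, norm_smul, Real.norm_eq_abs,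
        show t - c / 4 * t - t = -(c * t / 4) by ring, abs_neg, abs_of_pos (by positivity)]
      exact mul_le_of_le_one_right (by positivity) he
    have hct : c * t ≤ 1 := mul_le_one₀ hc1 ht0.le (hth.trans hh1)
    have h2 := hu _ (c * t) (by positivity) hct (hcone t ⟨ht0, hth⟩) _ hdist
    rw [dist_comm, Real.dist_eq]
    refine h2.trans ?_
    have h3 : (p ^ γ) ^ n = (p ^ n) ^ γ := by
      rw [← Real.rpow_natCast, ← Real.rpow_mul hp0.le, mul_comm, Real.rpow_mul hp0.le,
        Real.rpow_natCast]
    rw [h3, mul_assoc, ← Real.mul_rpow hh0.le (by positivity)]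
    gcongr
    refine hdist.trans ?_
    rw [← ht]
    nlinarith
  have := dist_le_of_le_geometric_of_tendsto₀ (p ^ γ) (D * h ^ γ) hpγ hstep htend
  simpa [Real.dist_eq] using this

/-- A Hölder bound between the vertices of two interior cones with the same axis direction. -/
lemma InteriorHolder.abs_sub_le_of_two_cones (hu : InteriorHolder Ω D γ u) (hΩ : IsOpen Ω)
    (hD : 0 < D) (hγ : 0 < γ) {x y e : E} (hx : x ∈ Ω) (hy : y ∈ Ω) (he : ‖e‖ ≤ 1) {c r : ℝ}
    (hc : c ∈ Ioc (0 : ℝ) 1) (hr : r ≤ 1)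
    (hcx : ∀ t ∈ Ioo 0 r, ball (x + t • e) (c * t) ⊆ Ω)
    (hcy : ∀ t ∈ Ioo 0 r, ball (y + t • e) (c * t) ⊆ Ω) (hxy : dist x y < c * r / 4) :
    |u x - u y| ≤ D * (1 + 2 * (4 / c) ^ γ / (1 - (1 - c / 4) ^ γ)) * dist x y ^ γ := by
  have hc0 := hc.1
  have hpγ : (1 - c / 4) ^ γ < 1 := Real.rpow_lt_one (by linarith [hc.2]) (by linarith) hγ
  rcases (dist_nonneg (x := x) (y := y)).eq_or_lt with h0 | h0
  · have hxy : x = y := dist_eq_zero.1 h0.symm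
    subst hxy
    simp [Real.zero_rpow hγ.ne']
  -- At this height `c h / 4 = dist x y`, so `y + h • e` lies in the quarter ball about `x + h • e`.
  obtain ⟨h, hh⟩ : ∃ h, h = 4 / c * dist x y := ⟨_, rfl⟩
  have hh0 : 0 < h := by rw [hh]; positivity
  have hch : c * h = 4 * dist x y := by rw [hh]; field_simp
  have hhr : h < r := by nlinarith
  have hmem : ∀ t ∈ Ioc 0 h, t ∈ Ioo 0 r := fun t ht => ⟨ht.1, ht.2.trans_lt hhr⟩
  have h1 := hu.abs_sub_le_of_cone hΩ hD hγ hx he hc ⟨hh0, by linarith⟩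
    fun t ht => hcx t (hmem t ht)
  have h2 := hu.abs_sub_le_of_cone hΩ hD hγ hy he hc ⟨hh0, by linarith⟩
    fun t ht => hcy t (hmem t ht)
  have h3 := hu (x + h • e) (c * h) (by positivity) (mul_le_one₀ hc.2 hh0.le (by linarith))
    (hcx h ⟨hh0, hhr⟩) (y + h • e) (by rw [dist_add_right, dist_comm, hch]; linarith)
  rw [dist_add_right, dist_comm] at h3
  have h4 : D * h ^ γ / (1 - (1 - c / 4) ^ γ)
      = D * ((4 / c) ^ γ / (1 - (1 - c / 4) ^ γ)) * dist x y ^ γ := by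
    rw [hh, Real.mul_rpow (by positivity) h0.le]; ring
  rw [h4] at h1 h2
  have key : D * (1 + 2 * (4 / c) ^ γ / (1 - (1 - c / 4) ^ γ)) * dist x y ^ γ
      = D * dist x y ^ γ + 2 * (D * ((4 / c) ^ γ / (1 - (1 - c / 4) ^ γ)) * dist x y ^ γ) := by ring
  rw [key]
  rw [abs_le] at h1 h2 h3 ⊢
  constructor <;> linarith [h1.1, h1.2, h2.1, h2.2, h3.1, h3.2]

end InteriorHolder

/-! ### Interior cones of the domain -/

section Cone

variable {N : ℕ} {Ω : Set (EuclideanSpace ℝ (Fin N))}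

/-- Interior cones near a boundary point. -/
lemma HasC11Boundary.exists_cone (h : HasC11Boundary Ω) {p : EuclideanSpace ℝ (Fin N)}
    (hp : p ∈ frontier Ω) :
    ∃ r : ℝ, 0 < r ∧ ∃ c ∈ Ioc (0 : ℝ) 1, ∃ e : EuclideanSpace ℝ (Fin N), ‖e‖ ≤ 1 ∧
      ∀ x ∈ Ω, x ∈ ball p r → ∀ t ∈ Ioo 0 r, ball (x + t • e) (c * t) ⊆ Ω := by
  obtain ⟨r, hr, e, he, g, hg, ⟨L, hL⟩, hgraph⟩ := h p hp
  -- The ball of radius `B` contains the projections of `ball p r`; `Λ` bounds the derivative of `g`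
  -- there.
  set B := 2 * (‖p‖ + r) with hB
  set Λ := ‖fderiv ℝ g 0‖ + L * B with hΛ
  have hΛ0 : 0 ≤ Λ := by positivity
  have hinner : ∀ w : EuclideanSpace ℝ (Fin N), |inner ℝ e w| ≤ ‖w‖ := fun w => by
    simpa [he] using abs_real_inner_le_norm e w
  have hproj : ∀ w : EuclideanSpace ℝ (Fin N), ‖w - inner ℝ e w • e‖ ≤ 2 * ‖w‖ := fun w => by
    refine (norm_sub_le _ _).trans ?_
    rw [norm_smul, he, mul_one, Real.norm_eq_abs]
    linarith [hinner w]
  have hmem : ∀ w ∈ ball p r, w - inner ℝ e w • e ∈ closedBall (0 : EuclideanSpace ℝ (Fin N)) B := by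
    intro w hw
    rw [mem_closedBall_zero_iff]
    have h1 : ‖w‖ ≤ ‖p‖ + r := by
      have := norm_le_norm_add_norm_sub p w
      linarith [mem_ball_iff_norm'.1 hw]
    linarith [hproj w]
  have hlip : ∀ a ∈ closedBall (0 : EuclideanSpace ℝ (Fin N)) B,
      ∀ b ∈ closedBall (0 : EuclideanSpace ℝ (Fin N)) B, ‖g b - g a‖ ≤ Λ * ‖b - a‖ := by
    intro a ha b hb
    refine (convex_closedBall _ B).norm_image_sub_le_of_norm_fderiv_le (𝕜 := ℝ)
      (fun w _ => hg w) (fun w hw => ?_) ha hb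
    have h1 := hL.dist_le_mul w 0
    rw [dist_eq_norm, dist_zero_right] at h1
    rw [mem_closedBall_zero_iff] at hw
    have h2 : (L : ℝ) * ‖w‖ ≤ L * B := by gcongr
    have h3 := norm_le_norm_add_norm_sub (fderiv ℝ g 0) (fderiv ℝ g w)
    rw [norm_sub_rev] at h3
    linarith
  -- A perturbation shorter than `c t` lowers the height by less than `c t` and changes `g` by at
  -- most `2 Λ c t`; this `c` makes the total equal the gain `t`.
  obtain ⟨c, hc⟩ : ∃ c, c = 1 / (1 + 2 * Λ) := ⟨_, rfl⟩
  have hc0 : 0 < c := by rw [hc]; positivity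
  have hcΛ : c * (1 + 2 * Λ) = 1 := by rw [hc]; field_simp
  have hc1 : c ≤ 1 := by nlinarith
  refine ⟨r / 4, by positivity, c, ⟨hc0, hc1⟩, e, he.le, fun x hx hxp t ht z hz => ?_⟩
  have ht0 := ht.1
  have hxr : x ∈ ball p r := ball_subset_ball (by linarith) hxp
  rw [mem_ball_iff_norm] at hz hxp
  obtain ⟨d, hd⟩ : ∃ d, d = z - (x + t • e) := ⟨_, rfl⟩
  rw [← hd] at hz
  have hz' : z = x + t • e + d := by rw [hd]; abel
  have hct : c * t ≤ t := mul_le_of_le_one_left ht0.le hc1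
  have hzr : z ∈ ball p r := by
    rw [mem_ball_iff_norm]
    calc ‖z - p‖ = ‖(x - p) + t • e + d‖ := by rw [hz']; congr 1; abel
      _ ≤ ‖x - p‖ + ‖t • e‖ + ‖d‖ := norm_add₃_le
      _ < r := by
        rw [norm_smul, he, Real.norm_of_nonneg ht0.le]
        linarith [ht.2]
  have hee : inner ℝ e e = (1 : ℝ) := by rw [real_inner_self_eq_norm_sq, he]; norm_num
  have hiz : inner ℝ e z = inner ℝ e x + t + inner ℝ e d := by
    rw [hz', inner_add_right, inner_add_right, inner_smul_right, hee, mul_one]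
  have hpz : z - inner ℝ e z • e - (x - inner ℝ e x • e) = d - inner ℝ e d • e := by
    rw [hiz, hz']; module
  rw [hgraph z hzr]
  have h1 := hlip _ (hmem x hxr) _ (hmem z hzr)
  rw [hpz, Real.norm_eq_abs] at h1
  have h2 : Λ * ‖d - inner ℝ e d • e‖ ≤ Λ * (2 * (c * t)) := by
    have := hproj d
    gcongr
    linarith
  have h3 := (hgraph x hxr).1 hx
  have h4 := (abs_le.1 (hinner d)).1
  have h5 : c * t + Λ * (2 * (c * t)) = t := by
    calc _ = c * (1 + 2 * Λ) * t := by ring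
      _ = t := by rw [hcΛ, one_mul]
  linarith [(abs_le.1 h1).2]

/-- Uniform interior cones with common axis direction for nearby points. -/
lemma HasC11Boundary.exists_uniform_cone (h : HasC11Boundary Ω) (hΩ : IsOpen Ω)
    (hΩ_bdd : Bornology.IsBounded Ω) :
    ∃ r ∈ Ioc (0 : ℝ) 1, ∃ c ∈ Ioc (0 : ℝ) 1, ∀ x ∈ Ω, ∀ y ∈ Ω, dist x y < r →
      ∃ e : EuclideanSpace ℝ (Fin N), ‖e‖ ≤ 1 ∧ (∀ t ∈ Ioo 0 r, ball (x + t • e) (c * t) ⊆ Ω) ∧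
        ∀ t ∈ Ioo 0 r, ball (y + t • e) (c * t) ⊆ Ω := by
  suffices H : ∃ r ∈ Ioc (0 : ℝ) 1, ∃ c ∈ Ioc (0 : ℝ) 1, ∀ x ∈ closure Ω, x ∈ Ω → ∀ y ∈ Ω,
      dist x y < r → ∃ e : EuclideanSpace ℝ (Fin N), ‖e‖ ≤ 1 ∧
        (∀ t ∈ Ioo 0 r, ball (x + t • e) (c * t) ⊆ Ω) ∧
        ∀ t ∈ Ioo 0 r, ball (y + t • e) (c * t) ⊆ Ω by
    obtain ⟨r, hr, c, hc, H⟩ := H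
    exact ⟨r, hr, c, hc, fun x hx => H x (subset_closure hx) hx⟩
  -- Only `x` is localized to `S`, while `y` ranges over `Ω`; the property then passes to unions by
  -- taking minima of `r` and `c`.
  refine hΩ_bdd.isCompact_closure.induction_on (p := fun S => ∃ r ∈ Ioc (0 : ℝ) 1,
    ∃ c ∈ Ioc (0 : ℝ) 1, ∀ x ∈ S, x ∈ Ω → ∀ y ∈ Ω, dist x y < r →
      ∃ e : EuclideanSpace ℝ (Fin N), ‖e‖ ≤ 1 ∧ (∀ t ∈ Ioo 0 r, ball (x + t • e) (c * t) ⊆ Ω) ∧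
        ∀ t ∈ Ioo 0 r, ball (y + t • e) (c * t) ⊆ Ω) ?_ ?_ ?_ ?_
  · exact ⟨1, by simp, 1, by simp, by simp⟩
  · rintro S T hST ⟨r, hr, c, hc, H⟩
    exact ⟨r, hr, c, hc, fun x hx => H x (hST hx)⟩
  · rintro S T ⟨r, hr, c, hc, H⟩ ⟨r', hr', c', hc', H'⟩
    have hmono : ∀ a b : ℝ, min r r' ≤ a → min c c' ≤ b → ∀ x e : EuclideanSpace ℝ (Fin N),
        (∀ t ∈ Ioo 0 a, ball (x + t • e) (b * t) ⊆ Ω) →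
        ∀ t ∈ Ioo 0 (min r r'), ball (x + t • e) (min c c' * t) ⊆ Ω :=
      fun a b ha hb x e hx t ht => (ball_subset_ball (mul_le_mul_of_nonneg_right hb ht.1.le)).trans
        (hx t ⟨ht.1, ht.2.trans_le ha⟩)
    refine ⟨min r r', ⟨lt_min hr.1 hr'.1, (min_le_left _ _).trans hr.2⟩, min c c',
      ⟨lt_min hc.1 hc'.1, (min_le_left _ _).trans hc.2⟩, fun x hx hxΩ y hy hxy => ?_⟩
    rcases hx with hx | hx
    · obtain ⟨e, he, h1, h2⟩ := H x hx hxΩ y hy (hxy.trans_le (min_le_left _ _))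
      exact ⟨e, he, hmono _ _ (min_le_left _ _) (min_le_left _ _) x e h1,
        hmono _ _ (min_le_left _ _) (min_le_left _ _) y e h2⟩
    · obtain ⟨e, he, h1, h2⟩ := H' x hx hxΩ y hy (hxy.trans_le (min_le_right _ _))
      exact ⟨e, he, hmono _ _ (min_le_right _ _) (min_le_right _ _) x e h1,
        hmono _ _ (min_le_right _ _) (min_le_right _ _) y e h2⟩
  · intro p hp
    obtain ⟨r, hr, c, hc, e, he, H⟩ : ∃ r : ℝ, 0 < r ∧ ∃ c ∈ Ioc (0 : ℝ) 1,
        ∃ e : EuclideanSpace ℝ (Fin N), ‖e‖ ≤ 1 ∧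
          ∀ x ∈ Ω, x ∈ ball p r → ∀ t ∈ Ioo 0 r, ball (x + t • e) (c * t) ⊆ Ω := by
      by_cases hpΩ : p ∈ Ω
      · obtain ⟨r, hr, hb⟩ := Metric.isOpen_iff.1 hΩ p hpΩ
        -- At an interior point the degenerate axis `e = 0` serves: the cones become balls about
        -- `x`.
        refine ⟨r / 2, by positivity, 1, by simp, 0, by simp, fun x _ hxp t ht => ?_⟩
        rw [smul_zero, add_zero, one_mul]
        refine (ball_subset_ball' ?_).trans hb
        linarith [mem_ball.1 hxp, ht.2]
      · exact h.exists_cone (by rw [hΩ.frontier_eq]; exact ⟨hp, hpΩ⟩)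
    refine ⟨ball p (r / 2), mem_nhdsWithin_of_mem_nhds (ball_mem_nhds p (by positivity)),
      min (r / 2) 1, ⟨lt_min (by positivity) one_pos, min_le_right _ _⟩, c, hc,
      fun x hx hxΩ y hy hxy => ⟨e, he, ?_, ?_⟩⟩
    · exact fun t ht => H x hxΩ (ball_subset_ball (by linarith) hx) t
        ⟨ht.1, ht.2.trans_le ((min_le_left _ _).trans (by linarith))⟩
    · refine fun t ht => H y hy ?_ t
        ⟨ht.1, ht.2.trans_le ((min_le_left _ _).trans (by linarith))⟩
      have h1 := dist_triangle y x p
      rw [dist_comm y x] at h1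
      have h2 := mem_ball.1 hx
      have h3 := hxy.trans_le (min_le_left (r / 2) 1)
      rw [mem_ball]
      linarith

end Cone

/-! ### Local and global Hölder bounds -/

section LocalHolder

variable {E : Type*} [NormedAddCommGroup E] {Ω : Set E} {D γ : ℝ} {u : E → ℝ}

lemma InteriorHolder.abs_sub_le_of_mem_ball (hu : InteriorHolder Ω D γ u) {x₀ : E} {R : ℝ}
    (hR : 0 < R) (hR1 : R ≤ 1) (hb : ball x₀ R ⊆ Ω) {x y : E} (hx : x ∈ ball x₀ (R / 16))
    (hy : y ∈ ball x₀ (R / 16)) : |u x - u y| ≤ D * dist x y ^ γ := by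
  rw [mem_ball] at hx hy
  -- Points of the `R/16` ball are within `R/8` of each other, a quarter of the radius `R/2`.
  refine hu y (R / 2) (by positivity) (by linarith) ((ball_subset_ball' (by linarith)).trans hb) x ?_
  have := dist_triangle_right x y x₀
  linarith

/-- A thickening of `S` inside `Ω` gives a uniform radius for close pairs; the oscillation bound
handles the others. -/
lemma InteriorHolder.exists_forall_isCompact {S : Set E} (hΩ : IsOpen Ω) (hγ : 0 < γ) (D K : ℝ)
    (hSΩ : S ⊆ Ω) (hS : IsCompact S) :
    ∃ C : ℝ, ∀ u : E → ℝ, InteriorHolder Ω D γ u → (∀ x ∈ Ω, ∀ y ∈ Ω, |u x - u y| ≤ K) →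
      ∀ x ∈ S, ∀ y ∈ S, |u x - u y| ≤ C * dist x y ^ γ := by
  obtain ⟨δ, hδ, hδΩ⟩ := hS.exists_thickening_subset_open hΩ hSΩ
  have hr : 0 < min δ 1 := lt_min hδ one_pos
  refine ⟨max D (K / (min δ 1 / 4) ^ γ), fun u hu hK x hx y hy => ?_⟩
  rcases le_total (dist x y) (min δ 1 / 4) with h | h
  · refine (hu y (min δ 1) hr (min_le_right _ _) ?_ x h).trans ?_
    · exact ((ball_subset_ball (min_le_left _ _)).trans (ball_subset_thickening hy δ)).trans hδΩ
    · gcongr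
      exact le_max_left _ _
  · refine (abs_sub_le_of_le_dist (by positivity) hγ (hK x (hSΩ hx) y (hSΩ hy)) h).trans ?_
    gcongr
    exact le_max_right _ _

end LocalHolder

/-- Global Hölder estimate on domains with `C^{1,1}` boundary. -/
lemma HasC11Boundary.exists_forall_abs_sub_le {N : ℕ} {Ω : Set (EuclideanSpace ℝ (Fin N))}
    (h : HasC11Boundary Ω) (hΩ : IsOpen Ω) (hΩ_bdd : Bornology.IsBounded Ω) {D γ : ℝ} (hD : 0 < D)
    (hγ : 0 < γ) (K : ℝ) :
    ∃ C : ℝ, ∀ u : EuclideanSpace ℝ (Fin N) → ℝ, InteriorHolder Ω D γ u →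
      (∀ x ∈ Ω, ∀ y ∈ Ω, |u x - u y| ≤ K) →
      ∀ x ∈ Ω, ∀ y ∈ Ω, |u x - u y| ≤ C * dist x y ^ γ := by
  obtain ⟨r, ⟨hr0, hr1⟩, c, ⟨hc0, hc1⟩, H⟩ := h.exists_uniform_cone hΩ hΩ_bdd
  refine ⟨max (D * (1 + 2 * (4 / c) ^ γ / (1 - (1 - c / 4) ^ γ))) (K / (c * r / 4) ^ γ),
    fun u hu hK x hx y hy => ?_⟩
  rcases lt_or_ge (dist x y) (c * r / 4) with hxy | hxy
  · have hxr : dist x y < r := by nlinarith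
    obtain ⟨e, he, hex, hey⟩ := H x hx y hy hxr
    refine (hu.abs_sub_le_of_two_cones hΩ hD hγ hx hy he ⟨hc0, hc1⟩ hr1 hex hey hxy).trans ?_
    gcongr
    exact le_max_left _ _
  · refine (abs_sub_le_of_le_dist (by positivity) hγ (hK x hx y hy) hxy).trans ?_
    gcongr
    exact le_max_right _ _

/-! ### The main theorem -/

theorem mainTheorem11 {N : ℕ} (Ω : Set (EuclideanSpace ℝ (Fin N)))
    (hΩ_open : IsOpen Ω) (hΩ_conn : IsConnected Ω) (hΩ_bdd : Bornology.IsBounded Ω)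
    (σ : ℝ) (hσ : σ ∈ Ioo (0 : ℝ) 1) (m : ℝ) (hm : m ∈ Ioc σ 1) (θ : ℝ) (hθ : θ ∈ Ico 0 m)
    (b₀ A : ℝ) (hb₀ : 0 < b₀) (hA : 0 < A)
    (γ : ℝ≥0) (hγ_pos : 0 < γ) (hγ : (γ : ℝ) < min ((m - σ) / m) ((m - θ) / m))
    (c₁ c₂ : ℝ → ℝ → ℝ) (K : ℝ) :
    ∃ (C : ℝ≥0) (ρ : EuclideanSpace ℝ (Fin N) → ℝ) (C' : Set (EuclideanSpace ℝ (Fin N)) → ℝ≥0),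
      (∀ x₀ ∈ Ω, 0 < ρ x₀) ∧
      ∀ ν : EuclideanSpace ℝ (Fin N) → Measure (EuclideanSpace ℝ (Fin N)),
        LevyM1 σ c₁ ν → LevyM2 σ c₂ ν →
        ∀ u : EuclideanSpace ℝ (Fin N) → ℝ,
          Measurable u → (∃ M : ℝ, ∀ x, |u x| ≤ M) →
          IsViscositySubsolution Ω ν m θ b₀ A u →
          oscillationOn (reachableSet Ω ν) u ≤ K →
            (∀ x₀ ∈ Ω, HolderOnWith C γ u (ball x₀ (ρ x₀))) ∧
            (∀ S ⊆ Ω, IsCompact S → HolderOnWith (C' S) γ u S) ∧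
            (HasC11Boundary Ω →
              HolderOnWith C γ u Ω ∧
              ∃ v : EuclideanSpace ℝ (Fin N) → ℝ,
                EqOn v u Ω ∧ HolderOnWith C γ v (closure Ω)) := by
  have hγ0 : (0 : ℝ) < γ := hγ_pos
  have hm0 : 0 < m := hσ.1.trans hm.1
  have hγσ : (γ : ℝ) * m < m - σ := (lt_div_iff₀ hm0).1 (hγ.trans_le (min_le_left _ _))
  have hγθ : (γ : ℝ) * m < m - θ := (lt_div_iff₀ hm0).1 (hγ.trans_le (min_le_right _ _))
  have hγ1 : (γ : ℝ) ≤ 1 := by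
    by_contra! hlt
    nlinarith [hσ.1]
  obtain ⟨D, hD, hDu⟩ := exists_interiorHolder hΩ_open hΩ_bdd hσ hm0 hθ.1 hb₀ hA hγ0 hγ1
    (by linarith) (by linarith) c₁ c₂ K
  -- Radii and constants are chosen before `ν` and `u`, hence are uniform in them; outside the
  -- relevant cases the value 0 is a dummy.
  have hball : ∀ x₀, ∃ R : ℝ, x₀ ∈ Ω → 0 < R ∧ R ≤ 1 ∧ ball x₀ R ⊆ Ω := by
    intro x₀
    by_cases hx₀ : x₀ ∈ Ω
    · obtain ⟨R, hR, hb⟩ := Metric.isOpen_iff.1 hΩ_open x₀ hx₀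
      exact ⟨min R 1, fun _ => ⟨lt_min hR one_pos, min_le_right _ _,
        (ball_subset_ball (min_le_left _ _)).trans hb⟩⟩
    · exact ⟨0, fun h => absurd h hx₀⟩
  choose R hR using hball
  have hcomp : ∀ S : Set (EuclideanSpace ℝ (Fin N)), ∃ C : ℝ, S ⊆ Ω → IsCompact S →
      ∀ u : EuclideanSpace ℝ (Fin N) → ℝ, InteriorHolder Ω D γ u →
        (∀ x ∈ Ω, ∀ y ∈ Ω, |u x - u y| ≤ K) →
        ∀ x ∈ S, ∀ y ∈ S, |u x - u y| ≤ C * dist x y ^ (γ : ℝ) := by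
    intro S
    by_cases hS : S ⊆ Ω ∧ IsCompact S
    · obtain ⟨C, hC⟩ := InteriorHolder.exists_forall_isCompact hΩ_open hγ0 D K hS.1 hS.2
      exact ⟨C, fun _ _ => hC⟩
    · exact ⟨0, fun h1 h2 => absurd ⟨h1, h2⟩ hS⟩
  choose C' hC' using hcomp
  obtain ⟨C₀, hC₀⟩ : ∃ C : ℝ, HasC11Boundary Ω →
      ∀ u : EuclideanSpace ℝ (Fin N) → ℝ, InteriorHolder Ω D γ u →
        (∀ x ∈ Ω, ∀ y ∈ Ω, |u x - u y| ≤ K) →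
        ∀ x ∈ Ω, ∀ y ∈ Ω, |u x - u y| ≤ C * dist x y ^ (γ : ℝ) := by
    by_cases h : HasC11Boundary Ω
    · obtain ⟨C, hC⟩ := h.exists_forall_abs_sub_le hΩ_open hΩ_bdd hD hγ0 K
      exact ⟨C, fun _ => hC⟩
    · exact ⟨0, fun h' => absurd h' h⟩
  refine ⟨(max D C₀).toNNReal, fun x₀ => R x₀ / 16, fun S => (C' S).toNNReal,
    fun x₀ hx₀ => div_pos (hR x₀ hx₀).1 (by norm_num), fun ν hν₁ hν₂ u _ ⟨M, hM⟩ hu hK => ?_⟩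
  have hI := hDu ν hν₁ hν₂ u ⟨M, hM⟩ hu hK
  have hosc : ∀ x ∈ Ω, ∀ y ∈ Ω, |u x - u y| ≤ K := by
    intro x hx y hy
    have hsub : Ω ⊆ reachableSet Ω ν := subset_union_left
    have h1 := sub_le_of_oscillationOn_le hM hK (hsub hx) (hsub hy)
    have h2 := sub_le_of_oscillationOn_le hM hK (hsub hy) (hsub hx)
    rw [abs_le]
    constructor <;> linarith
  refine ⟨fun x₀ hx₀ => holderOnWith_of_abs_sub_le fun x hx y hy => ?_,
    fun S hSΩ hS => holderOnWith_of_abs_sub_le fun x hx y hy => ?_, fun h => ?_⟩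
  · obtain ⟨h0, h1, hb⟩ := hR x₀ hx₀
    refine (hI.abs_sub_le_of_mem_ball h0 h1 hb hx hy).trans ?_
    gcongr
    exact (le_max_left _ _).trans (Real.le_coe_toNNReal _)
  · refine (hC' S hSΩ hS u hI hosc x hx y hy).trans ?_
    gcongr
    exact Real.le_coe_toNNReal _
  · have hglob : ∀ x ∈ Ω, ∀ y ∈ Ω,
        |u x - u y| ≤ (max D C₀).toNNReal * dist x y ^ (γ : ℝ) := by
      intro x hx y hy
      refine (hC₀ h u hI hosc x hx y hy).trans ?_
      gcongr
      exact (le_max_right _ _).trans (Real.le_coe_toNNReal _)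
    obtain ⟨v, hv, hvC⟩ := exists_holder_extension hΩ_conn.nonempty hγ_pos hγ1 hM hglob
    exact ⟨holderOnWith_of_abs_sub_le hglob, v, hv, hvC _⟩
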